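/- Let $X_1,X_2,\dots$ be i.i.d. centered random vectors in $\mathbb{R}^p$ ($p$ fixed) with finite second moments and positive definite covariance matrix $C$, and let $\varepsilon_1,\varepsilon_2,\dots$ be i.i.d. centered real random variables with finite variance $\sigma^2$, the sequence $(X_i)_i$ being independent of the sequence $(\varepsilon_i)_i$. Fix $\beta^0\in\mathbb{R}^p$ and let $y_i=X_i^{T}\beta^0+\varepsilon_i$. Let $f:\mathbb{R}^p\to\mathbb{R}$ be any convex function, and let $f_n=n^{1/2}f$ or, more generally, $f_n=n^{1/2}(f+\rho_n)$, where each $f_n$ is convex, $\rho_n(\beta)\to 0$ for every $\beta\in\mathbb{R}^p$, and $\rho_n$ is Lipschitz continuous with a constant $c_n$ such that $c_n\to 0$ as $n\to\infty$. Let $$\hat\beta_n\in\underset{\beta\in\mathbb{R}^p}{\operatorname{argmin}}\ \frac12\sum_{i=1}^n (y_i-X_i^{T}\beta)^2+f_n(\beta)$$ be a measurable choice of minimizer (with an arbitrary value at outcomes for which there is no minimizer). Almost surely, for all sufficiently large $n$, the minimizer exists and is unique. Moreover $$\sqrt n\,(\hat\beta_n-\beta^0)\ \overset{d}{\longrightarrow}\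 \hat u:=\underset{u\in\mathbb{R}^p}{\operatorname{argmin}}\ V(u),\qquad V(u)=\frac12u^{T}Cu-u^{T}W+f'(\beta^0;u),$$ where $W\sim\mathcal N(0,\sigma^2C)$ and $f'(\beta^0;u)=\lim_{t\downarrow 0}\big(f(\beta^0+tu)-f(\beta^0)\big)/t$ is the directional derivative of $f$ at $\beta^0$ in direction $u$; for every value of $W$, the minimizer of $V$ exists and is unique. -/

import Mathlib

open MeasureTheory ProbabilityTheory Filter Topology
open scoped NNReal

/-- The (one-sided) directional derivative `f'(x; u) = lim_{t ↓ 0} (f (x + t u) - f x) / t`. -/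
noncomputable def dirDeriv {p : ℕ} (f : EuclideanSpace ℝ (Fin p) → ℝ)
    (x u : EuclideanSpace ℝ (Fin p)) : ℝ :=
  limUnder (𝓝[>] (0 : ℝ)) (fun t : ℝ => (f (x + t • u) - f x) / t)

/-- For a convex function the limit defining the directional derivative always exists. -/
theorem tendsto_dirDeriv {p : ℕ} {f : EuclideanSpace ℝ (Fin p) → ℝ}
    (hf : ConvexOn ℝ Set.univ f) (x u : EuclideanSpace ℝ (Fin p)) :
    Tendsto (fun t : ℝ => (f (x + t • u) - f x) / t) (𝓝[>] (0 : ℝ)) (𝓝 (dirDeriv f x u)) := by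
  have hg : ConvexOn ℝ Set.univ (fun t : ℝ => f (x + t • u)) := by
    refine ⟨convex_univ, fun a _ b _ s t hs ht hst => ?_⟩
    have h := hf.2 (Set.mem_univ (x + a • u)) (Set.mem_univ (x + b • u)) hs ht hst
    have e : s • (x + a • u) + t • (x + b • u) = x + (s • a + t • b) • u := by
      have : s • x + t • x = x := by rw [← add_smul, hst, one_smul]
      calc s • (x + a • u) + t • (x + b • u)
          = (s • x + t • x) + (s • a + t • b) • u := by
            simp only [smul_add, add_smul, smul_smul, smul_eq_mul]; abel
        _ = _ := by rw [this]
    rw [e] at h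
    exact h
  have hd := hg.hasDerivWithinAt_rightDeriv_of_mem_interior (x := 0) (by simp)
  rw [hasDerivWithinAt_iff_tendsto_slope' (by simp)] at hd
  refine tendsto_nhds_limUnder ⟨_, hd.congr fun t => ?_⟩
  simp [slope_def_field]

/-- The response `y_i = X_iᵀ β⁰ + ε_i` of the linear model. The design vectors `X i` are the
rows of the design matrix. -/
noncomputable def response {p : ℕ} {Ω : Type*} (X : ℕ → Ω → EuclideanSpace ℝ (Fin p))
    (ε : ℕ → Ω → ℝ) (β₀ : EuclideanSpace ℝ (Fin p)) (i : ℕ) (ω : Ω) : ℝ :=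
  inner ℝ (X i ω) β₀ + ε i ω

/-- The penalized least squares objective `½ ‖y - X β‖² + pen β` built on the first `n`
observations. -/
noncomputable def penalizedLS {p : ℕ} {Ω : Type*} (X : ℕ → Ω → EuclideanSpace ℝ (Fin p))
    (ε : ℕ → Ω → ℝ) (β₀ : EuclideanSpace ℝ (Fin p)) (pen : EuclideanSpace ℝ (Fin p) → ℝ)
    (n : ℕ) (ω : Ω) (β : EuclideanSpace ℝ (Fin p)) : ℝ :=
  1 / 2 * ∑ i ∈ Finset.range n, (response X ε β₀ i ω - inner ℝ (X i ω) β) ^ 2 + pen β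

/-- The limiting objective `V(u) = ½ uᵀ C u - uᵀ w + f'(β⁰; u)`. -/
noncomputable def limitObjective {p : ℕ} (C : Matrix (Fin p) (Fin p) ℝ)
    (f : EuclideanSpace ℝ (Fin p) → ℝ) (β₀ w u : EuclideanSpace ℝ (Fin p)) : ℝ :=
  1 / 2 * (u.ofLp ⬝ᵥ C.mulVec u.ofLp) - inner ℝ u w + dirDeriv f β₀ u

/-! Substituting `β = β₀ + u/√n` and subtracting the value at `β₀` turns the objective into `½⟪u,
Bₙu⟫ - ⟪u, Zₙ⟫ + hₙ(u)`, with `Bₙ` the empirical second moment, `Zₙ` the normalized score and `hₙ`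
the scaled penalty increment (`penalizedLS_rescale`). Here `Bₙ → A` almost surely, where `A` has the
quadratic form of `C`; `Zₙ → W` in distribution by the CLT; and `hₙ → f'(β₀; ·)` uniformly on balls.
Let `m(w)` minimize the limiting objective with linear term `w`. Strong convexity makes `m`
Lipschitz, so `m(Zₙ) → m(W)` by continuous mapping. The rescaled estimator minimizes a small
perturbation, on a large ball, of the objective minimized by `m(Zₙ)`, so their difference tends to 0
in probability (`tendstoInMeasure_sub_argmin_quadObjective`), and Slutsky's theorem concludes.
Existence and uniqueness hold as soon as `Bₙ` is so close to `A` that it is itself positive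
definite. -/

/-! ### Minimizers of strongly convex functions and their stability. -/

section ConvexMinimization

variable {E : Type*} [NormedAddCommGroup E]

section NormedSpace

variable [NormedSpace ℝ E] {F : E → ℝ} {m : ℝ}

/-- A strongly convex function grows at least quadratically away from a minimizer. -/
theorem StrongConvexOn.add_sq_le_of_isMinOn (hF : StrongConvexOn Set.univ m F) {a : E}
    (ha : IsMinOn F Set.univ a) (u : E) : F a + m / 2 * ‖u - a‖ ^ 2 ≤ F u := by
  -- Compare `F a` with `F` at `a + t(u - a)`, divide by `t`, then let `t ↓ 0`.
  have key : ∀ t ∈ Set.Ioo (0 : ℝ) 1, F a + (1 - t) * (m / 2 * ‖u - a‖ ^ 2) ≤ F u := by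
    rintro t ⟨h0, h1⟩
    have h := hF.2 (Set.mem_univ u) (Set.mem_univ a) h0.le (sub_nonneg.2 h1.le) (by ring)
    have h' := ha (Set.mem_univ (t • u + (1 - t) • a))
    simp only [Set.mem_ofPred_eq, smul_eq_mul] at h h'
    have : t * (F a + (1 - t) * (m / 2 * ‖u - a‖ ^ 2)) ≤ t * F u := by linarith
    exact le_of_mul_le_mul_left this h0
  have hlim : Tendsto (fun t : ℝ => F a + (1 - t) * (m / 2 * ‖u - a‖ ^ 2)) (𝓝[>] 0)
      (𝓝 (F a + (1 - 0) * (m / 2 * ‖u - a‖ ^ 2))) :=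
    (Continuous.tendsto (by fun_prop) 0).mono_left nhdsWithin_le_nhds
  have := le_of_tendsto hlim
    (Filter.mem_of_superset (Ioo_mem_nhdsGT (zero_lt_one' ℝ)) key)
  simpa using this

/-- A strongly convex function on a finite-dimensional space has a unique minimizer. -/
theorem StrongConvexOn.existsUnique_isMinOn [FiniteDimensional ℝ E]
    (hF : StrongConvexOn Set.univ m F) (hm : 0 < m) : ∃! a, IsMinOn F Set.univ a := by
  have hconv : ConvexOn ℝ Set.univ F := hF.convexOn (fun r => by positivity)
  have hcont : Continuous F := hconv.locallyLipschitz.continuous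
  have : ProperSpace E := FiniteDimensional.proper ℝ E
  obtain ⟨K, hK⟩ := (isCompact_closedBall (0 : E) 1).exists_bound_of_continuousOn
    (f := fun u => F u - F 0) (by fun_prop)
  have hco : ∀ᶠ u in cocompact E, F 0 ≤ F u := by
    -- Strong convexity between `0` and `u`, at the unit vector `u/‖u‖` where `F - F 0 ≥ -K`, forces
    -- `F u ≥ F 0` once `m(‖u‖ - 1) ≥ 2K`.
    filter_upwards [tendsto_norm_cocompact_atTop.eventually_ge_atTop (1 + |2 * K / m|)] with u hu
    have hr1 : 1 ≤ ‖u‖ := le_trans (by linarith [abs_nonneg (2 * K / m)]) hu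
    have hr0 : 0 < ‖u‖ := by linarith
    have ht1 : ‖u‖⁻¹ ≤ 1 := inv_le_one_of_one_le₀ hr1
    have h := hF.2 (Set.mem_univ u) (Set.mem_univ 0) (inv_nonneg.2 hr0.le)
      (sub_nonneg.2 ht1) (by ring)
    have hk := hK (‖u‖⁻¹ • u) (by
      rw [mem_closedBall_zero_iff, norm_smul, norm_inv, norm_norm, inv_mul_cancel₀ hr0.ne'])
    rw [Real.norm_eq_abs, abs_le] at hk
    simp only [smul_zero, add_zero, smul_eq_mul, sub_zero] at h
    have e1 : 2 * K ≤ m * (‖u‖ - 1) := by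
      have := (le_abs_self (2 * K / m)).trans (by linarith : |2 * K / m| ≤ ‖u‖ - 1)
      rw [div_le_iff₀ hm] at this
      linarith
    have h2 : ‖u‖⁻¹ * (m * ‖u‖ ^ 2 / 2 - m * ‖u‖ / 2) - K ≤ ‖u‖⁻¹ * (F u - F 0) := by
      have e : ‖u‖⁻¹ * (1 - ‖u‖⁻¹) * (m / 2 * ‖u‖ ^ 2)
          = ‖u‖⁻¹ * (m * ‖u‖ ^ 2 / 2 - m * ‖u‖ / 2) := by field_simp
      rw [e] at h
      linarith [hk.1]
    have h3 : ‖u‖⁻¹ * (m * ‖u‖ ^ 2 / 2 - m * ‖u‖ / 2) = m * (‖u‖ - 1) / 2 := by field_simp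
    have h4 : 0 ≤ ‖u‖⁻¹ * (F u - F 0) := by linarith
    linarith [(mul_nonneg_iff_of_pos_left (inv_pos.2 hr0)).1 h4]
  obtain ⟨a, ha⟩ := hcont.exists_forall_le' 0 hco
  refine ⟨a, fun u _ => ha u, fun b hb => ?_⟩
  have h1 := hF.add_sq_le_of_isMinOn (a := a) (fun u _ => ha u) b
  have h2 : F b ≤ F a := hb (Set.mem_univ a)
  have h3 : ‖b - a‖ ^ 2 = 0 := by nlinarith [sq_nonneg ‖b - a‖]
  simpa [sub_eq_zero] using h3

/-- If a convex function exceeds its value at `a` on a sphere around `a`, then its minimizers lie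
inside that sphere. -/
theorem ConvexOn.norm_sub_lt_of_isMinOn_of_lt_sphere (hF : ConvexOn ℝ Set.univ F) {a b : E} {δ : ℝ}
    (hδ : 0 < δ) (hs : ∀ u, ‖u - a‖ = δ → F a < F u) (hb : IsMinOn F Set.univ b) :
    ‖b - a‖ < δ := by
  by_contra! h
  have hr : 0 < ‖b - a‖ := hδ.trans_le h
  have ht0 : 0 ≤ δ / ‖b - a‖ := by positivity
  have ht1 : δ / ‖b - a‖ ≤ 1 := (div_le_one hr).2 h
  have hc := hF.2 (Set.mem_univ b) (Set.mem_univ a) ht0 (sub_nonneg.2 ht1) (by ring)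
  have hz := hs ((δ / ‖b - a‖) • b + (1 - δ / ‖b - a‖) • a) (by
    have : (δ / ‖b - a‖) • b + (1 - δ / ‖b - a‖) • a - a = (δ / ‖b - a‖) • (b - a) := by
      module
    rw [this, norm_smul, Real.norm_of_nonneg ht0, div_mul_cancel₀ _ hr.ne'])
  have hba : F b ≤ F a := hb (Set.mem_univ a)
  simp only [smul_eq_mul] at hc
  nlinarith [mul_le_mul_of_nonneg_left hba ht0]

end NormedSpace

variable [InnerProductSpace ℝ E]

/-- The convex objective `½ ⟪u, A u⟫ - ⟪u, w⟫ + g u`. -/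
noncomputable def quadObjective (A : E →L[ℝ] E) (w : E) (g : E → ℝ) (u : E) : ℝ :=
  1 / 2 * inner ℝ u (A u) - inner ℝ u w + g u

/-- For `q(u) = ⟪u, Au⟫` and `a + b = 1`, `a q(x) + b q(y) - q(ax + by) = ab q(x - y)`; no symmetry
of `A` is needed. -/
theorem strongConvexOn_quadObjective {A : E →L[ℝ] E} {l : ℝ}
    (hA : ∀ u, l * ‖u‖ ^ 2 ≤ inner ℝ u (A u)) (w : E) {g : E → ℝ} (hg : ConvexOn ℝ Set.univ g) :
    StrongConvexOn Set.univ l (quadObjective A w g) := by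
  refine ⟨convex_univ, fun x _ y _ a b ha hb hab => ?_⟩
  have h := hg.2 (Set.mem_univ x) (Set.mem_univ y) ha hb hab
  have hq := mul_le_mul_of_nonneg_left (hA (x - y)) (mul_nonneg ha hb)
  obtain rfl : b = 1 - a := by linarith
  simp only [quadObjective, map_add, map_sub, map_smul, inner_add_left, inner_add_right,
    inner_sub_left, inner_sub_right, real_inner_smul_left, real_inner_smul_right,
    smul_eq_mul] at h hq ⊢
  linear_combination h + hq / 2

/-- Adding the quadratic growth bounds at the two minimizers cancels the forms and penalties,
leaving `l‖u₁ - u₂‖² ≤ ⟪u₁ - u₂, w₁ - w₂⟫`. -/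
theorem norm_sub_le_of_isMinOn_quadObjective {A : E →L[ℝ] E} {l : ℝ} (hl : 0 < l)
    (hA : ∀ u, l * ‖u‖ ^ 2 ≤ inner ℝ u (A u)) {g : E → ℝ} (hg : ConvexOn ℝ Set.univ g)
    {w₁ w₂ u₁ u₂ : E} (h₁ : IsMinOn (quadObjective A w₁ g) Set.univ u₁)
    (h₂ : IsMinOn (quadObjective A w₂ g) Set.univ u₂) : ‖u₁ - u₂‖ ≤ l⁻¹ * ‖w₁ - w₂‖ := by
  have e₁ := (strongConvexOn_quadObjective hA w₁ hg).add_sq_le_of_isMinOn h₁ u₂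
  have e₂ := (strongConvexOn_quadObjective hA w₂ hg).add_sq_le_of_isMinOn h₂ u₁
  have hcs := real_inner_le_norm (u₁ - u₂) (w₁ - w₂)
  rw [norm_sub_rev u₂ u₁] at e₁
  simp only [quadObjective, inner_sub_left, inner_sub_right] at e₁ e₂ hcs
  have key : l * ‖u₁ - u₂‖ ^ 2 ≤ ‖u₁ - u₂‖ * ‖w₁ - w₂‖ := by linarith
  rw [inv_mul_eq_div, le_div_iff₀ hl]
  rcases (norm_nonneg (u₁ - u₂)).eq_or_lt with h | h
  · rw [← h]; simp
  · exact le_of_mul_le_mul_left (by linarith) h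

/-- A minimizer of a quadratic objective is close to the minimizer `a` of a coercive one if the
penalties and the quadratic forms are close on a ball. -/
theorem norm_sub_lt_of_isMinOn_quadObjective {A B : E →L[ℝ] E} {l : ℝ}
    (hA : ∀ u, l * ‖u‖ ^ 2 ≤ inner ℝ u (A u)) (hB : ∀ u, 0 ≤ inner ℝ u (B u)) {g h : E → ℝ}
    (hg : ConvexOn ℝ Set.univ g) (hh : ConvexOn ℝ Set.univ h) {w a b : E}
    (ha : IsMinOn (quadObjective A w g) Set.univ a) (hb : IsMinOn (quadObjective B w h) Set.univ b)
    {R δ η κ : ℝ} (hδ : 0 < δ) (haR : ‖a‖ + δ ≤ R) (hgh : ∀ u, ‖u‖ ≤ R → |h u - g u| ≤ η)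
    (hAB : ‖B - A‖ ≤ κ) (hsmall : 2 * η + κ * R ^ 2 < l / 2 * δ ^ 2) : ‖b - a‖ < δ := by
  have hBc : ConvexOn ℝ Set.univ (quadObjective B w h) := by
    have := strongConvexOn_quadObjective (l := 0) (A := B) (by simpa using hB) w hh
    simpa using this
  have hclose : ∀ u, ‖u‖ ≤ R →
      |quadObjective B w h u - quadObjective A w g u| ≤ η + κ * R ^ 2 / 2 := by
    intro u hu
    have e : quadObjective B w h u - quadObjective A w g u
        = 1 / 2 * inner ℝ u ((B - A) u) + (h u - g u) := by
      simp only [quadObjective, sub_apply, inner_sub_right]; ring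
    have h1 : |inner ℝ u ((B - A) u)| ≤ κ * R ^ 2 := by
      have hκ : 0 ≤ κ := (norm_nonneg _).trans hAB
      have hR : 0 ≤ R := (norm_nonneg _).trans hu
      calc |inner ℝ u ((B - A) u)| ≤ ‖u‖ * ‖(B - A) u‖ := abs_real_inner_le_norm _ _
        _ ≤ ‖u‖ * (‖B - A‖ * ‖u‖) := by gcongr; exact (B - A).le_opNorm u
        _ ≤ R * (κ * R) := by gcongr
        _ = κ * R ^ 2 := by ring
    rw [e]
    refine (abs_add_le _ _).trans ?_
    rw [abs_mul, abs_of_nonneg (by norm_num : (0 : ℝ) ≤ 1 / 2)]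
    linarith [hgh u hu]
  -- Nothing bounds `b` a priori, so only the sphere of radius `δ` is compared: there the growth
  -- `l/2 * δ²` exceeds twice the perturbation error.
  refine hBc.norm_sub_lt_of_isMinOn_of_lt_sphere hδ (fun u hu => ?_) hb
  have hgrow := (strongConvexOn_quadObjective hA w hg).add_sq_le_of_isMinOn ha u
  have huR : ‖u‖ ≤ R := by
    calc ‖u‖ = ‖(u - a) + a‖ := by simp
      _ ≤ ‖u - a‖ + ‖a‖ := norm_add_le _ _
      _ ≤ R := by linarith
  have c1 := abs_le.1 (hclose u huR)
  have c2 := abs_le.1 (hclose a (by linarith))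
  rw [hu] at hgrow
  linarith [c1.1, c2.2]

end ConvexMinimization

/-! ### Uniform convergence of difference quotients and scaled penalties. -/

section DirectionalDerivative

variable {p : ℕ} {f : EuclideanSpace ℝ (Fin p) → ℝ}

theorem ConvexOn.comp_const_add_smul (hf : ConvexOn ℝ Set.univ f) (x : EuclideanSpace ℝ (Fin p))
    (t : ℝ) : ConvexOn ℝ Set.univ (fun u => f (x + t • u)) := by
  refine ⟨convex_univ, fun u _ v _ a b ha hb hab => ?_⟩
  have h := hf.2 (Set.mem_univ (x + t • u)) (Set.mem_univ (x + t • v)) ha hb hab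
  have e : a • (x + t • u) + b • (x + t • v) = x + t • (a • u + b • v) := by
    obtain rfl : b = 1 - a := by linarith
    module
  rwa [e] at h

theorem convexOn_dirDeriv (hf : ConvexOn ℝ Set.univ f) (x : EuclideanSpace ℝ (Fin p)) :
    ConvexOn ℝ Set.univ (dirDeriv f x) := by
  refine ⟨convex_univ, fun u _ v _ a b ha hb hab => ?_⟩
  refine le_of_tendsto_of_tendsto (tendsto_dirDeriv hf x (a • u + b • v))
    (((tendsto_dirDeriv hf x u).const_smul a).add ((tendsto_dirDeriv hf x v).const_smul b)) ?_
  filter_upwards [self_mem_nhdsWithin] with t ht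
  have ht : 0 < t := ht
  have h := (hf.comp_const_add_smul x t).2 (Set.mem_univ u) (Set.mem_univ v) ha hb hab
  simp only [smul_eq_mul] at h ⊢
  have e : a * ((f (x + t • u) - f x) / t) + b * ((f (x + t • v) - f x) / t)
      = (a * f (x + t • u) + b * f (x + t • v) - f x) / t := by
    obtain rfl : b = 1 - a := by linarith
    field_simp
    ring
  rw [e]
  gcongr

/-- The difference quotients of a convex function converge to the directional derivative
uniformly on balls. -/
theorem tendstoUniformlyOn_dirDeriv (hf : ConvexOn ℝ Set.univ f) (x : EuclideanSpace ℝ (Fin p))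
    (R : ℝ) : TendstoUniformlyOn (fun (t : ℝ) u => (f (x + t • u) - f x) / t) (dirDeriv f x)
      (𝓝[>] 0) (Metric.closedBall 0 R) := by
  obtain ⟨K, s, hs, hK⟩ := hf.locallyLipschitz x
  obtain ⟨r, hr, hrs⟩ := Metric.mem_nhds_iff.1 hs
  -- A local Lipschitz constant of `f` at `x` is inherited by the quotients for small `t`, hence by
  -- their limit; this equicontinuity upgrades pointwise to uniform convergence on compact sets.
  have hlip : ∀ R' > 0, ∀ᶠ t : ℝ in 𝓝[>] 0, ∀ u v : EuclideanSpace ℝ (Fin p), ‖u‖ < R' → ‖v‖ < R' →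
      |(f (x + t • u) - f x) / t - (f (x + t • v) - f x) / t| ≤ K * ‖u - v‖ := by
    intro R' hR'
    filter_upwards [Ioo_mem_nhdsGT (show 0 < r / R' by positivity)] with t ht u v hu hv
    have hmem : ∀ u : EuclideanSpace ℝ (Fin p), ‖u‖ < R' → x + t • u ∈ s := by
      intro u hu
      refine hrs ?_
      rw [Metric.mem_ball, dist_eq_norm, add_sub_cancel_left, norm_smul,
        Real.norm_of_nonneg ht.1.le]
      have h2 := (lt_div_iff₀ hR').1 ht.2
      exact lt_of_le_of_lt (mul_le_mul_of_nonneg_left hu.le ht.1.le) h2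
    have h := hK.dist_le_mul _ (hmem u hu) _ (hmem v hv)
    rw [Real.dist_eq, dist_eq_norm, add_sub_add_left_eq_sub, ← smul_sub, norm_smul,
      Real.norm_of_nonneg ht.1.le] at h
    rw [← sub_div, sub_sub_sub_cancel_right, abs_div, abs_of_pos ht.1, div_le_iff₀ ht.1]
    linarith
  have hlip' : ∀ u v : EuclideanSpace ℝ (Fin p),
      |dirDeriv f x u - dirDeriv f x v| ≤ K * ‖u - v‖ := by
    intro u v
    refine le_of_tendsto (((tendsto_dirDeriv hf x u).sub (tendsto_dirDeriv hf x v)).abs) ?_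
    filter_upwards [hlip (max ‖u‖ ‖v‖ + 1) (by positivity)] with t ht
    exact ht u v (by linarith [le_max_left ‖u‖ ‖v‖]) (by linarith [le_max_right ‖u‖ ‖v‖])
  rw [← tendstoLocallyUniformlyOn_iff_tendstoUniformlyOn_of_compact
    (isCompact_closedBall _ _), Metric.tendstoLocallyUniformlyOn_iff]
  intro ε hε u _
  have hd : 0 < ε / (3 * (K + 1)) := by positivity
  refine ⟨Metric.ball u (min 1 (ε / (3 * (K + 1)))), mem_nhdsWithin_of_mem_nhds
    (Metric.ball_mem_nhds _ (lt_min one_pos hd)), ?_⟩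
  filter_upwards [hlip (‖u‖ + 1) (by positivity),
    (Metric.tendsto_nhds.1 (tendsto_dirDeriv hf x u)) (ε / 3) (by positivity)] with t ht htu v hv
  rw [Metric.mem_ball, dist_eq_norm] at hv
  have hv1 : ‖v‖ < ‖u‖ + 1 := by
    have := norm_sub_norm_le v u
    linarith [hv.trans_le (min_le_left _ _)]
  have hKv : K * ‖v - u‖ < ε / 3 := by
    have h1 := hv.trans_le (min_le_right _ _)
    rw [lt_div_iff₀ (by positivity)] at h1
    nlinarith [norm_nonneg (v - u)]
  have a1 := abs_le.1 (ht v u hv1 (by linarith))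
  have a2 := abs_le.1 (hlip' v u)
  rw [Real.dist_eq, abs_lt] at htu
  rw [Real.dist_eq, abs_lt]
  constructor <;> linarith [a1.1, a1.2, a2.1, a2.2, htu.1, htu.2]

theorem tendsto_inv_sqrt_natCast_nhdsGT :
    Tendsto (fun n : ℕ => (√(n : ℝ))⁻¹) atTop (𝓝[>] 0) :=
  tendsto_inv_atTop_nhdsGT_zero.comp (Real.tendsto_sqrt_atTop.comp tendsto_natCast_atTop_atTop)

/-- The penalty increment at scale `n^{-1/2}` around `x`. -/
noncomputable def scaledPenalty (h : EuclideanSpace ℝ (Fin p) → ℝ) (x : EuclideanSpace ℝ (Fin p))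
    (n : ℕ) (u : EuclideanSpace ℝ (Fin p)) : ℝ :=
  √(n : ℝ) * h (x + (√(n : ℝ))⁻¹ • u) - √(n : ℝ) * h x

theorem convexOn_scaledPenalty {h : EuclideanSpace ℝ (Fin p) → ℝ} {n : ℕ}
    (hh : ConvexOn ℝ Set.univ (fun β => √(n : ℝ) * h β)) (x : EuclideanSpace ℝ (Fin p)) :
    ConvexOn ℝ Set.univ (scaledPenalty h x n) := by
  simpa only [scaledPenalty, sub_eq_add_neg] using!
    (hh.comp_const_add_smul x (√(n : ℝ))⁻¹).add_const (-(√(n : ℝ) * h x))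

/-- The `f` part is the difference quotient at `t = n^{-1/2}`; the increment of `√n ρₙ` is at most
`cₙ‖u‖`, as the two scalings cancel. -/
theorem eventually_abs_scaledPenalty_sub_dirDeriv_le (hf : ConvexOn ℝ Set.univ f)
    (x : EuclideanSpace ℝ (Fin p)) {ρ : ℕ → EuclideanSpace ℝ (Fin p) → ℝ} {c : ℕ → ℝ≥0}
    (hρ : ∀ n, LipschitzWith (c n) (ρ n)) (hc : Tendsto c atTop (𝓝 0)) (R : ℝ) {η : ℝ}
    (hη : 0 < η) : ∀ᶠ n : ℕ in atTop, ∀ u : EuclideanSpace ℝ (Fin p), ‖u‖ ≤ R →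
      |scaledPenalty (fun β => f β + ρ n β) x n u - dirDeriv f x u| ≤ η := by
  have h1 := tendsto_inv_sqrt_natCast_nhdsGT.eventually
    (Metric.tendstoUniformlyOn_iff.1 (tendstoUniformlyOn_dirDeriv hf x R) (η / 2) (by positivity))
  have h2 : Tendsto (fun n => (c n : ℝ) * R) atTop (𝓝 (0 * R)) :=
    (NNReal.tendsto_coe.2 hc).mul_const R
  rw [zero_mul] at h2
  filter_upwards [h1, h2.eventually_le_const (show 0 < η / 2 by positivity),
    eventually_gt_atTop 0] with n hn hcn hpos u hu
  have hs : 0 < √(n : ℝ) := Real.sqrt_pos.2 (by exact_mod_cast hpos)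
  have a1 := hn u (by simpa using hu)
  rw [Real.dist_eq, div_inv_eq_mul, abs_lt] at a1
  have a2 := (hρ n).dist_le_mul (x + (√(n : ℝ))⁻¹ • u) x
  rw [dist_eq_norm (_ + _), add_sub_cancel_left, norm_smul, norm_inv, Real.norm_of_nonneg hs.le,
    Real.dist_eq] at a2
  have a3 : |√(n : ℝ) * (ρ n (x + (√(n : ℝ))⁻¹ • u) - ρ n x)| ≤ η / 2 := by
    rw [abs_mul, abs_of_pos hs]
    calc √(n : ℝ) * |ρ n (x + (√(n : ℝ))⁻¹ • u) - ρ n x|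
        ≤ √(n : ℝ) * (c n * ((√(n : ℝ))⁻¹ * ‖u‖)) := by gcongr
      _ = c n * ‖u‖ := by field_simp
      _ ≤ c n * R := by gcongr
      _ ≤ η / 2 := hcn
  rw [abs_le] at a3 ⊢
  simp only [scaledPenalty]
  constructor <;> linarith [a1.1, a1.2, a3.1, a3.2]

end DirectionalDerivative

/-! ### Local reparametrization at scale `n^{-1/2}`. -/

section Rescaling

variable {p : ℕ} {Ω : Type*}

/-- The empirical second moment operator `n⁻¹ ∑ X_i X_iᵀ`. -/
noncomputable def empiricalSecondMoment (X : ℕ → Ω → EuclideanSpace ℝ (Fin p)) (n : ℕ) (ω : Ω) :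
    EuclideanSpace ℝ (Fin p) →L[ℝ] EuclideanSpace ℝ (Fin p) :=
  (n : ℝ)⁻¹ • ∑ i ∈ Finset.range n, InnerProductSpace.rankOne ℝ (X i ω) (X i ω)

/-- The normalized score `n^{-1/2} ∑ ε_i X_i`. -/
noncomputable def normalizedScore (X : ℕ → Ω → EuclideanSpace ℝ (Fin p)) (ε : ℕ → Ω → ℝ) (n : ℕ)
    (ω : Ω) : EuclideanSpace ℝ (Fin p) :=
  (√(n : ℝ))⁻¹ • ∑ i ∈ Finset.range n, ε i ω • X i ω

theorem inner_empiricalSecondMoment_self (X : ℕ → Ω → EuclideanSpace ℝ (Fin p)) (n : ℕ) (ω : Ω)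
    (u : EuclideanSpace ℝ (Fin p)) :
    inner ℝ u (empiricalSecondMoment X n ω u)
      = (n : ℝ)⁻¹ * ∑ i ∈ Finset.range n, (inner ℝ (X i ω) u) ^ 2 := by
  simp only [empiricalSecondMoment, smul_apply, sum_apply, real_inner_smul_right, inner_sum,
    InnerProductSpace.rankOne_apply]
  congr 1
  refine Finset.sum_congr rfl fun i _ => ?_
  rw [real_inner_comm u, sq]

/-- The residual at `β₀` is `ε i`, so the cross terms of the expanded squares form the score. -/
theorem penalizedLS_rescale (X : ℕ → Ω → EuclideanSpace ℝ (Fin p)) (ε : ℕ → Ω → ℝ)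
    (β₀ : EuclideanSpace ℝ (Fin p)) (h : EuclideanSpace ℝ (Fin p) → ℝ) (n : ℕ) (ω : Ω)
    (u : EuclideanSpace ℝ (Fin p)) :
    penalizedLS X ε β₀ (fun β => √(n : ℝ) * h β) n ω (β₀ + (√(n : ℝ))⁻¹ • u)
      = penalizedLS X ε β₀ (fun β => √(n : ℝ) * h β) n ω β₀
        + quadObjective (empiricalSecondMoment X n ω) (normalizedScore X ε n ω)
          (scaledPenalty h β₀ n) u := by
  have hs : (√(n : ℝ))⁻¹ ^ 2 = (n : ℝ)⁻¹ := by rw [inv_pow, Real.sq_sqrt n.cast_nonneg]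
  have e1 : ∀ i, (response X ε β₀ i ω - inner ℝ (X i ω) (β₀ + (√(n : ℝ))⁻¹ • u)) ^ 2
      = (response X ε β₀ i ω - inner ℝ (X i ω) β₀) ^ 2
        - 2 * (√(n : ℝ))⁻¹ * (ε i ω * inner ℝ (X i ω) u)
        + (n : ℝ)⁻¹ * (inner ℝ (X i ω) u) ^ 2 := by
    intro i
    rw [← hs]
    simp only [response, inner_add_right, real_inner_smul_right]
    ring
  have e2 : inner ℝ u (normalizedScore X ε n ω)
      = (√(n : ℝ))⁻¹ * ∑ i ∈ Finset.range n, ε i ω * inner ℝ (X i ω) u := by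
    simp only [normalizedScore, real_inner_smul_right, inner_sum, real_inner_comm u]
  simp only [penalizedLS, quadObjective, scaledPenalty, inner_empiricalSecondMoment_self, e2, e1,
    Finset.sum_add_distrib, Finset.sum_sub_distrib, ← Finset.mul_sum]
  ring

theorem isMinOn_penalizedLS_iff (X : ℕ → Ω → EuclideanSpace ℝ (Fin p)) (ε : ℕ → Ω → ℝ)
    (β₀ : EuclideanSpace ℝ (Fin p)) (h : EuclideanSpace ℝ (Fin p) → ℝ) {n : ℕ} (hn : 0 < n) (ω : Ω)
    (β : EuclideanSpace ℝ (Fin p)) :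
    IsMinOn (penalizedLS X ε β₀ (fun β => √(n : ℝ) * h β) n ω) Set.univ β ↔
      IsMinOn (quadObjective (empiricalSecondMoment X n ω) (normalizedScore X ε n ω)
        (scaledPenalty h β₀ n)) Set.univ (√(n : ℝ) • (β - β₀)) := by
  have hs : √(n : ℝ) ≠ 0 := (Real.sqrt_pos.2 (by exact_mod_cast hn)).ne'
  have hβ : ∀ β, β = β₀ + (√(n : ℝ))⁻¹ • (√(n : ℝ) • (β - β₀)) := by
    intro β
    rw [inv_smul_smul₀ hs, add_sub_cancel]
  simp only [isMinOn_univ_iff]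
  constructor
  · intro H u
    have := H (β₀ + (√(n : ℝ))⁻¹ • u)
    rw [hβ β, penalizedLS_rescale X ε β₀ h n, penalizedLS_rescale X ε β₀ h n] at this
    linarith
  · intro H γ
    rw [hβ β, hβ γ, penalizedLS_rescale X ε β₀ h n, penalizedLS_rescale X ε β₀ h n]
    linarith [H (√(n : ℝ) • (γ - β₀))]

theorem existsUnique_isMinOn_penalizedLS (X : ℕ → Ω → EuclideanSpace ℝ (Fin p)) (ε : ℕ → Ω → ℝ)
    (β₀ : EuclideanSpace ℝ (Fin p)) {h : EuclideanSpace ℝ (Fin p) → ℝ} {n : ℕ} (hn : 0 < n) (ω : Ω)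
    (hh : ConvexOn ℝ Set.univ (fun β => √(n : ℝ) * h β)) {l : ℝ} (hl : 0 < l)
    (hA : ∀ u, l * ‖u‖ ^ 2 ≤ inner ℝ u (empiricalSecondMoment X n ω u)) :
    ∃! β, IsMinOn (penalizedLS X ε β₀ (fun β => √(n : ℝ) * h β) n ω) Set.univ β := by
  have hs : √(n : ℝ) ≠ 0 := (Real.sqrt_pos.2 (by exact_mod_cast hn)).ne'
  obtain ⟨u, hu, huniq⟩ := (strongConvexOn_quadObjective hA (normalizedScore X ε n ω)
    (convexOn_scaledPenalty hh β₀)).existsUnique_isMinOn hl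
  refine ⟨β₀ + (√(n : ℝ))⁻¹ • u, ?_, fun γ hγ => ?_⟩
  · beta_reduce
    rwa [isMinOn_penalizedLS_iff X ε β₀ h hn, add_sub_cancel_left, smul_inv_smul₀ hs]
  · rw [← huniq _ ((isMinOn_penalizedLS_iff X ε β₀ h hn ω γ).1 hγ), inv_smul_smul₀ hs,
      add_sub_cancel]

end Rescaling

/-! ### Independence of pairs and the Cramér–Wold device. -/

section Independence

/-- If two independent sequences consist of independent variables, then so does the sequence of
pairs. -/
theorem ProbabilityTheory.iIndepFun.prodMk_of_indepFun {Ω ι α β : Type*} [MeasurableSpace Ω]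
    [MeasurableSpace α] [MeasurableSpace β] {μ : Measure Ω} {X : ι → Ω → α} {Y : ι → Ω → β}
    (hX : ∀ i, Measurable (X i)) (hY : ∀ i, Measurable (Y i)) (hXi : iIndepFun X μ)
    (hYi : iIndepFun Y μ) (hXY : IndepFun (fun ω i => X i ω) (fun ω i => Y i ω) μ) :
    iIndepFun (fun i ω => (X i ω, Y i ω)) μ := by
  refine iIndepSets.iIndep (fun i => ((hX i).prodMk (hY i)).comap_le)
    (fun i => (fun t => (fun ω => (X i ω, Y i ω)) ⁻¹' t) ''
      (Set.image2 (· ×ˢ ·) {s : Set α | MeasurableSet s} {t : Set β | MeasurableSet t}))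
    (fun i => isPiSystem_prod.comap _) (fun i => ?_) ?_
  · rw [← MeasurableSpace.comap_generateFrom, generateFrom_prod]
  · rw [iIndepSets_iff]
    intro s E hE
    have hE' : ∀ i ∈ s, ∃ A B, MeasurableSet A ∧ MeasurableSet B ∧
        E i = X i ⁻¹' A ∩ Y i ⁻¹' B := by
      intro i hi
      obtain ⟨_, ⟨A, hA, B, hB, rfl⟩, h⟩ := hE i hi
      exact ⟨A, B, hA, hB, h.symm⟩
    choose! A B hA hB hAB using hE'
    have hinter : ⋂ i ∈ s, E i = (⋂ i ∈ s, X i ⁻¹' A i) ∩ ⋂ i ∈ s, Y i ⁻¹' B i := by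
      ext ω
      simp only [Set.mem_iInter, Set.mem_inter_iff]
      constructor
      · intro h
        exact ⟨fun i hi => ((hAB i hi) ▸ h i hi).1, fun i hi => ((hAB i hi) ▸ h i hi).2⟩
      · rintro ⟨h1, h2⟩ i hi
        rw [hAB i hi]
        exact ⟨h1 i hi, h2 i hi⟩
    -- Independence of the two sequences separates the factors, then each sequence factorizes. The
    -- case `s' = {i}` later identifies `μ (E i)`.
    have hsplit : ∀ s' ⊆ s, μ ((⋂ i ∈ s', X i ⁻¹' A i) ∩ ⋂ i ∈ s', Y i ⁻¹' B i)
        = (∏ i ∈ s', μ (X i ⁻¹' A i)) * ∏ i ∈ s', μ (Y i ⁻¹' B i) := by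
      intro s' hs'
      have h := hXY.measure_inter_preimage_eq_mul (⋂ i ∈ s', (fun x : ι → α => x i) ⁻¹' A i)
        (⋂ i ∈ s', (fun x : ι → β => x i) ⁻¹' B i)
        (Finset.measurableSet_biInter _ fun i hi => (measurable_pi_apply i) (hA i (hs' hi)))
        (Finset.measurableSet_biInter _ fun i hi => (measurable_pi_apply i) (hB i (hs' hi)))
      simp only [Set.preimage_iInter, ← Set.preimage_comp] at h
      rw [← hXi.measure_inter_preimage_eq_mul s' fun i hi => hA i (hs' hi),
        ← hYi.measure_inter_preimage_eq_mul s' fun i hi => hB i (hs' hi)]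
      exact h
    rw [hinter, hsplit s subset_rfl, ← Finset.prod_mul_distrib]
    refine Finset.prod_congr rfl fun i hi => ?_
    have := hsplit {i} (Finset.singleton_subset_iff.2 hi)
    simp only [Finset.mem_singleton, Set.iInter_iInter_eq_left, Finset.prod_singleton] at this
    rw [hAB i hi, this]

theorem ProbabilityTheory.charFun_map_eq_charFun_map_inner {Ω E : Type*} [MeasurableSpace Ω]
    {μ : Measure Ω} [NormedAddCommGroup E] [InnerProductSpace ℝ E] [SecondCountableTopology E]
    [MeasurableSpace E] [BorelSpace E] {Y : Ω → E} (hY : AEMeasurable Y μ) (t : E) :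
    charFun (μ.map Y) t = charFun (μ.map (fun ω => (inner ℝ (Y ω) t : ℝ))) 1 := by
  rw [charFun_apply, charFun_apply, integral_map hY (by fun_prop),
    integral_map (by fun_prop) (by fun_prop)]
  simp

/-- **Cramér–Wold device**. -/
theorem MeasureTheory.tendstoInDistribution_of_forall_inner {Ω Ω' E : Type*} [MeasurableSpace Ω]
    [MeasurableSpace Ω'] {μ : Measure Ω} [IsProbabilityMeasure μ] {ν : Measure Ω'}
    [IsProbabilityMeasure ν] [NormedAddCommGroup E] [InnerProductSpace ℝ E] [FiniteDimensional ℝ E]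
    [MeasurableSpace E] [BorelSpace E] {Z : ℕ → Ω → E} {W : Ω' → E}
    (hZ : ∀ n, AEMeasurable (Z n) μ) (hW : AEMeasurable W ν)
    (h : ∀ t : E, TendstoInDistribution (fun n ω => inner ℝ (Z n ω) t) atTop
      (fun ω => inner ℝ (W ω) t) (fun _ => μ) ν) :
    TendstoInDistribution Z atTop W (fun _ => μ) ν := by
  refine ⟨hZ, hW, ProbabilityMeasure.tendsto_iff_tendsto_charFun.2 fun t => ?_⟩
  have := ProbabilityMeasure.tendsto_iff_tendsto_charFun.1 (h t).tendsto 1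
  simp only [ProbabilityMeasure.coe_mk] at this ⊢
  rw [charFun_map_eq_charFun_map_inner hW]
  refine this.congr fun n => ?_
  exact (charFun_map_eq_charFun_map_inner (hZ n) t).symm

end Independence

/-! ### Second moments and the law of large numbers. -/

section SecondMoments

variable {p : ℕ} {Ω : Type*} [MeasurableSpace Ω] {μ : Measure Ω}

/-- By homogeneity, `l` can be the minimum of the form on the compact unit sphere; an empty sphere
means the space is trivial. -/
theorem Matrix.PosDef.exists_pos_mul_norm_sq_le {C : Matrix (Fin p) (Fin p) ℝ} (hC : C.PosDef) :
    ∃ l > 0, ∀ u : EuclideanSpace ℝ (Fin p), l * ‖u‖ ^ 2 ≤ u.ofLp ⬝ᵥ C.mulVec u.ofLp := by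
  have hpos : ∀ u : EuclideanSpace ℝ (Fin p), u ≠ 0 → 0 < u.ofLp ⬝ᵥ C.mulVec u.ofLp := by
    intro u hu
    have := hC.dotProduct_mulVec_pos (x := u.ofLp) (by simpa using hu)
    simpa using this
  have hcont : Continuous fun u : EuclideanSpace ℝ (Fin p) => u.ofLp ⬝ᵥ C.mulVec u.ofLp := by
    fun_prop
  rcases (Metric.sphere (0 : EuclideanSpace ℝ (Fin p)) 1).eq_empty_or_nonempty with he | hne
  · refine ⟨1, one_pos, fun u => ?_⟩
    have hu : u = 0 := by
      by_contra hu
      have : ‖u‖⁻¹ • u ∈ Metric.sphere (0 : EuclideanSpace ℝ (Fin p)) 1 := by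
        simp [norm_smul, inv_mul_cancel₀ (norm_ne_zero_iff.2 hu)]
      simp [he] at this
    simp [hu]
  · obtain ⟨v, hv, hmin⟩ := (isCompact_sphere (0 : EuclideanSpace ℝ (Fin p)) 1).exists_isMinOn hne
      hcont.continuousOn
    have hv0 : v ≠ 0 := by
      rintro rfl
      simp at hv
    refine ⟨_, hpos v hv0, fun u => ?_⟩
    rcases eq_or_ne u 0 with rfl | hu
    · simp
    · have hn : ‖u‖ ≠ 0 := norm_ne_zero_iff.2 hu
      have h := hmin (show ‖u‖⁻¹ • u ∈ Metric.sphere (0 : EuclideanSpace ℝ (Fin p)) 1 by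
        simp [norm_smul, inv_mul_cancel₀ hn])
      simp only [Set.mem_ofPred_eq, WithLp.ofLp_smul, Matrix.mulVec_smul, smul_dotProduct,
        dotProduct_smul, smul_eq_mul] at h
      calc _ ≤ ‖u‖⁻¹ * (‖u‖⁻¹ * (u.ofLp ⬝ᵥ C.mulVec u.ofLp)) * ‖u‖ ^ 2 := by gcongr
        _ = _ := by field_simp

theorem integral_inner_sq_eq_dotProduct_mulVec [IsProbabilityMeasure μ]
    {C : Matrix (Fin p) (Fin p) ℝ}
    {Y : Ω → EuclideanSpace ℝ (Fin p)} (hY : Measurable Y) (hL : MemLp Y 2 μ)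
    (hmean : ∫ ω, Y ω ∂μ = 0)
    (hcov : ∀ j k, covariance (fun ω => Y ω j) (fun ω => Y ω k) μ = C j k)
    (u : EuclideanSpace ℝ (Fin p)) :
    ∫ ω, (inner ℝ (Y ω) u) ^ 2 ∂μ = u.ofLp ⬝ᵥ C.mulVec u.ofLp := by
  have hcoord : ∀ i, MemLp (fun ω => Y ω i) 2 μ := fun i =>
    (EuclideanSpace.proj (𝕜 := ℝ) i).comp_memLp' hL
  have h1 := covarianceBilin_apply_pi hcoord u u
  have hmap : (fun ω => WithLp.toLp 2 fun i => Y ω i) = Y := rfl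
  have hid : MemLp id 2 (μ.map Y) := (memLp_map_measure_iff (by fun_prop) hY.aemeasurable).2 hL
  have : IsProbabilityMeasure (μ.map Y) := Measure.isProbabilityMeasure_map hY.aemeasurable
  rw [hmap, covarianceBilin_self hid, variance_map (by fun_prop) hY.aemeasurable] at h1
  have hi : ∫ ω, inner ℝ u (Y ω) ∂μ = 0 := by
    rw [integral_inner (hL.integrable (by simp)), hmean, inner_zero_right]
  rw [variance_of_integral_eq_zero (by fun_prop) (by simpa using hi)] at h1
  simp only [Function.comp_apply] at h1
  simp_rw [real_inner_comm u]
  rw [h1]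
  simp only [hcov, dotProduct, Matrix.mulVec, Finset.mul_sum]
  refine Finset.sum_congr rfl fun i _ => Finset.sum_congr rfl fun j _ => by ring

theorem integrable_rankOne_self {Y : Ω → EuclideanSpace ℝ (Fin p)} (hL : MemLp Y 2 μ) :
    Integrable (fun ω => InnerProductSpace.rankOne ℝ (Y ω) (Y ω)) μ := by
  refine (hL.integrable_norm_pow (by simp)).mono ?_ (ae_of_all _ fun ω => ?_)
  · have : Continuous fun y : EuclideanSpace ℝ (Fin p) => InnerProductSpace.rankOne ℝ y y := by
      simp only [InnerProductSpace.rankOne_def]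
      fun_prop
    exact this.comp_aestronglyMeasurable hL.1
  · simp [sq]

theorem inner_integral_rankOne_self {Y : Ω → EuclideanSpace ℝ (Fin p)} (hL : MemLp Y 2 μ)
    (u : EuclideanSpace ℝ (Fin p)) :
    inner ℝ u ((∫ ω, InnerProductSpace.rankOne ℝ (Y ω) (Y ω) ∂μ) u)
      = ∫ ω, (inner ℝ (Y ω) u) ^ 2 ∂μ := by
  have hI := integrable_rankOne_self hL
  rw [ContinuousLinearMap.integral_apply hI, ← integral_inner (hI.apply_continuousLinearMap u)]
  refine integral_congr_ae (ae_of_all _ fun ω => ?_)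
  simp only [InnerProductSpace.rankOne_apply, real_inner_smul_right]
  rw [real_inner_comm u, sq]

/-- The strong law is applied directly in the space of operators, which gives convergence in
operator norm, hence of the quadratic forms uniformly on balls. -/
theorem tendsto_empiricalSecondMoment {X : ℕ → Ω → EuclideanSpace ℝ (Fin p)}
    (hX_indep : iIndepFun X μ) (hX_ident : ∀ i, IdentDistrib (X i) (X 0) μ μ)
    (hX_memLp : MemLp (X 0) 2 μ) :
    ∀ᵐ ω ∂μ, Tendsto (fun n => empiricalSecondMoment X n ω) atTop
      (𝓝 (∫ ω, InnerProductSpace.rankOne ℝ (X 0 ω) (X 0 ω) ∂μ)) := by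
  let E := EuclideanSpace ℝ (Fin p)
  borelize (E →L[ℝ] E)
  have hc : Continuous fun y : E => InnerProductSpace.rankOne ℝ y y := by
    simp only [InnerProductSpace.rankOne_def]
    fun_prop
  exact strong_law_ae (fun i ω => InnerProductSpace.rankOne ℝ (X i ω) (X i ω))
    (integrable_rankOne_self hX_memLp)
    (fun i j hij => (hX_indep.indepFun hij).comp hc.measurable hc.measurable)
    (fun i => (hX_ident i).comp hc.measurable)

end SecondMoments

/-! ### Central limit theorem for the score. -/

section Score

variable {p : ℕ} {Ω Ω' : Type*} [MeasurableSpace Ω] [MeasurableSpace Ω'] {μ : Measure Ω}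
  [IsProbabilityMeasure μ] {ν : Measure Ω'} [IsProbabilityMeasure ν]

/-- Independence factorizes the second moment of the product, so no fourth moments are required. -/
theorem variance_mul_inner {C : Matrix (Fin p) (Fin p) ℝ} {σ : ℝ}
    {Y : Ω → EuclideanSpace ℝ (Fin p)} {e : Ω → ℝ} (hY : Measurable Y) (hL : MemLp Y 2 μ)
    (hmean : ∫ ω, Y ω ∂μ = 0)
    (hcov : ∀ j k, covariance (fun ω => Y ω j) (fun ω => Y ω k) μ = C j k)
    (he : MemLp e 2 μ) (he0 : ∫ ω, e ω ∂μ = 0) (hvar : variance e μ = σ ^ 2)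
    (hind : IndepFun Y e μ) (t : EuclideanSpace ℝ (Fin p)) :
    MemLp (fun ω => e ω * inner ℝ (Y ω) t) 2 μ ∧ ∫ ω, e ω * inner ℝ (Y ω) t ∂μ = 0 ∧
      variance (fun ω => e ω * inner ℝ (Y ω) t) μ = σ ^ 2 * (t.ofLp ⬝ᵥ C.mulVec t.ofLp) := by
  have hin : Measurable fun y : EuclideanSpace ℝ (Fin p) => (inner ℝ y t : ℝ) := by fun_prop
  have hI : MemLp (fun ω => (inner ℝ (Y ω) t : ℝ)) 2 μ := hL.inner_const t
  have hind1 : IndepFun e (fun ω => (inner ℝ (Y ω) t : ℝ)) μ :=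
    hind.symm.comp measurable_id hin
  have hind2 : IndepFun (fun ω => e ω ^ 2) (fun ω => (inner ℝ (Y ω) t : ℝ) ^ 2) μ :=
    hind1.comp (φ := fun x : ℝ => x ^ 2) (ψ := fun x : ℝ => x ^ 2) (by fun_prop) (by fun_prop)
  have hmeas : AEStronglyMeasurable (fun ω => e ω * inner ℝ (Y ω) t) μ := he.1.mul hI.1
  have hsq : ∀ ω, (e ω * inner ℝ (Y ω) t) ^ 2 = e ω ^ 2 * (inner ℝ (Y ω) t) ^ 2 :=
    fun ω => mul_pow _ _ _
  have hzero : ∫ ω, e ω * inner ℝ (Y ω) t ∂μ = 0 := by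
    rw [hind1.integral_fun_mul_eq_mul_integral he.1 hI.1, he0, zero_mul]
  refine ⟨?_, hzero, ?_⟩
  · rw [memLp_two_iff_integrable_sq hmeas]
    simp_rw [hsq]
    exact hind2.integrable_mul he.integrable_sq hI.integrable_sq
  · rw [variance_of_integral_eq_zero hmeas.aemeasurable hzero]
    simp_rw [hsq]
    rw [hind2.integral_fun_mul_eq_mul_integral (he.1.pow 2) (hI.1.pow 2),
      integral_inner_sq_eq_dotProduct_mulVec hY hL hmean hcov t,
      ← variance_of_integral_eq_zero he.1.aemeasurable he0, hvar]

/-- By Cramér–Wold it suffices to apply the scalar CLT to `ε i * ⟪X i, t⟫`, whose variance `σ² tᵀCt`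
is that of `⟪W, t⟫`. -/
theorem tendstoInDistribution_normalizedScore {C : Matrix (Fin p) (Fin p) ℝ} (hC : C.PosSemidef)
    {σ : ℝ} {X : ℕ → Ω → EuclideanSpace ℝ (Fin p)} (hX_meas : ∀ i, Measurable (X i))
    (hX_indep : iIndepFun X μ) (hX_ident : ∀ i, IdentDistrib (X i) (X 0) μ μ)
    (hX_memLp : MemLp (X 0) 2 μ) (hX_mean : ∫ ω, X 0 ω ∂μ = 0)
    (hX_cov : ∀ j k, covariance (fun ω => X 0 ω j) (fun ω => X 0 ω k) μ = C j k)
    {ε : ℕ → Ω → ℝ} (hε_meas : ∀ i, Measurable (ε i)) (hε_indep : iIndepFun ε μ)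
    (hε_ident : ∀ i, IdentDistrib (ε i) (ε 0) μ μ) (hε_memLp : MemLp (ε 0) 2 μ)
    (hε_mean : ∫ ω, ε 0 ω ∂μ = 0) (hε_var : variance (ε 0) μ = σ ^ 2)
    (hXε : IndepFun (fun ω i => X i ω) (fun ω i => ε i ω) μ)
    {W : Ω' → EuclideanSpace ℝ (Fin p)} (hW : HasLaw W (multivariateGaussian 0 (σ ^ 2 • C)) ν) :
    TendstoInDistribution (normalizedScore X ε) atTop W (fun _ => μ) ν := by
  have hpair := iIndepFun.prodMk_of_indepFun hX_meas hε_meas hX_indep hε_indep hXε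
  have hi : ∀ i, IndepFun (X i) (ε i) μ := fun i =>
    hXε.comp (measurable_pi_apply i) (measurable_pi_apply i)
  have hident : ∀ i, IdentDistrib (fun ω => (X i ω, ε i ω)) (fun ω => (X 0 ω, ε 0 ω)) μ μ :=
    fun i => (hX_ident i).prodMk (hε_ident i) (hi i) (hi 0)
  have hmeas : ∀ n, Measurable (normalizedScore X ε n) := fun n => by
    unfold normalizedScore
    have : Measurable fun ω => ∑ i ∈ Finset.range n, ε i ω • X i ω :=
      Finset.measurable_sum _ fun i _ => (hε_meas i).smul (hX_meas i)
    exact this.const_smul (√(n : ℝ))⁻¹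
  refine tendstoInDistribution_of_forall_inner (fun n => (hmeas n).aemeasurable)
    hW.aemeasurable fun t => ?_
  obtain ⟨hL, h0, hvar⟩ := variance_mul_inner (hX_meas 0) hX_memLp hX_mean hX_cov hε_memLp hε_mean
    hε_var (hi 0) t
  let φ : EuclideanSpace ℝ (Fin p) × ℝ → ℝ := fun z => z.2 * inner ℝ z.1 t
  have hφ : Measurable φ := by fun_prop
  have hlaw : HasLaw (fun ω => (inner ℝ (W ω) t : ℝ))
      (gaussianReal 0 Var[fun ω => ε 0 ω * inner ℝ (X 0 ω) t; μ].toNNReal) ν := by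
    have hWm := hW.aemeasurable
    refine ⟨by fun_prop, Measure.ext_of_charFun (funext fun s => ?_)⟩
    have hnn : 0 ≤ Var[fun ω => ε 0 ω * inner ℝ (X 0 ω) t; μ] := variance_nonneg _ _
    have h1 : charFun (ν.map fun ω => (inner ℝ (W ω) t : ℝ)) s = charFun (ν.map W) (s • t) := by
      rw [charFun_apply, charFun_apply, integral_map (by fun_prop) (by fun_prop),
        integral_map hWm (by fun_prop)]
      simp [real_inner_smul_right, mul_comm]
    rw [h1, hW.map_eq, charFun_multivariateGaussian (hC.smul (sq_nonneg σ)), charFun_gaussianReal,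
      Real.coe_toNNReal _ hnn, hvar]
    simp [Matrix.mulVec_smul, Matrix.smul_mulVec]
    ring_nf
  have hclt := tendstoInDistribution_inv_sqrt_mul_sum_sub
    (X := fun i ω => ε i ω * inner ℝ (X i ω) t) hlaw hL
    (hpair.comp (fun _ => φ) (fun _ => hφ)) (fun i => (hident i).comp hφ)
  simp only [h0, mul_zero, sub_zero] at hclt
  convert! hclt using 3 with n ω
  simp only [normalizedScore, real_inner_smul_left, sum_inner]

end Score

/-! ### Tightness and comparison of the two minimizers. -/

section Estimator

variable {p : ℕ} {Ω Ω' : Type*} [MeasurableSpace Ω] [MeasurableSpace Ω'] {μ : Measure Ω}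
  [IsProbabilityMeasure μ] {ν : Measure Ω'} [IsProbabilityMeasure ν]

/-- A sequence converging in distribution is bounded in probability. -/
theorem MeasureTheory.TendstoInDistribution.exists_forall_measure_lt_norm_le
    {E : Type*} [NormedAddCommGroup E] [InnerProductSpace ℝ E] [FiniteDimensional ℝ E]
    [MeasurableSpace E] [BorelSpace E] {Z : ℕ → Ω → E} {W : Ω' → E}
    (h : TendstoInDistribution Z atTop W (fun _ => μ) ν) {δ : ENNReal} (hδ : 0 < δ) :
    ∃ R : ℝ, ∀ n, μ {ω | R < ‖Z n ω‖} ≤ δ := by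
  have : IsProbabilityMeasure (ν.map W) := Measure.isProbabilityMeasure_map h.aemeasurable_limit
  have : ∀ n, IsProbabilityMeasure (μ.map (Z n)) := fun n =>
    Measure.isProbabilityMeasure_map (h.forall_aemeasurable n)
  -- Characteristic functions converging pointwise to a function continuous at 0 force tightness.
  have ht : IsTightMeasureSet (Set.range fun n => μ.map (Z n)) :=
    isTightMeasureSet_of_tendsto_charFun (f := charFun (ν.map W)) (by fun_prop)
      (fun t => ProbabilityMeasure.tendsto_iff_tendsto_charFun.1 h.tendsto t)
  obtain ⟨K, hK, hKδ⟩ := isTightMeasureSet_iff_exists_isCompact_measure_compl_le.1 ht δ hδ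
  obtain ⟨R, hR⟩ := hK.isBounded.exists_norm_le
  refine ⟨R, fun n => ?_⟩
  calc μ {ω | R < ‖Z n ω‖} ≤ μ (Z n ⁻¹' Kᶜ) :=
        measure_mono fun ω hω hmem => (hR _ hmem).not_gt hω
    _ = μ.map (Z n) Kᶜ :=
        (Measure.map_apply_of_aemeasurable (h.forall_aemeasurable n) hK.measurableSet.compl).symm
    _ ≤ δ := hKδ _ ⟨n, rfl⟩

/-- Up to probability `θ`, `Z n` is bounded and `B n` is close to `A`; there the deterministic
stability bound applies. -/
theorem tendstoInMeasure_sub_argmin_quadObjective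
    {E : Type*} [NormedAddCommGroup E] [InnerProductSpace ℝ E] [FiniteDimensional ℝ E]
    [MeasurableSpace E] [BorelSpace E] {A : E →L[ℝ] E} {l : ℝ} (hl : 0 < l)
    (hA : ∀ u, l * ‖u‖ ^ 2 ≤ inner ℝ u (A u)) {g : E → ℝ} (hg : ConvexOn ℝ Set.univ g)
    {m : E → E} (hm : ∀ w, IsMinOn (quadObjective A w g) Set.univ (m w))
    {B : ℕ → Ω → E →L[ℝ] E} (hBm : ∀ n, AEStronglyMeasurable (B n) μ)
    (hB : ∀ᵐ ω ∂μ, Tendsto (fun n => B n ω) atTop (𝓝 A)) (hB0 : ∀ n ω u, 0 ≤ inner ℝ u (B n ω u))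
    {h : ℕ → E → ℝ} (hh : ∀ n, ConvexOn ℝ Set.univ (h n))
    (hgh : ∀ R : ℝ, ∀ η > 0, ∀ᶠ n in atTop, ∀ u, ‖u‖ ≤ R → |h n u - g u| ≤ η)
    {Z : ℕ → Ω → E} {W : Ω' → E} (hZ : TendstoInDistribution Z atTop W (fun _ => μ) ν)
    {U : ℕ → Ω → E} {κ₀ : ℝ} (hκ₀ : 0 < κ₀)
    (hU : ∀ᶠ n in atTop, ∀ᵐ ω ∂μ, ‖B n ω - A‖ < κ₀ →
      IsMinOn (quadObjective (B n ω) (Z n ω) (h n)) Set.univ (U n ω)) :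
    TendstoInMeasure μ (U - fun n ω => m (Z n ω)) atTop 0 := by
  rw [tendstoInMeasure_iff_norm]
  intro δ hδ
  rw [ENNReal.tendsto_nhds_zero]
  intro θ hθ
  have hθ2 : 0 < θ / 2 := ENNReal.half_pos hθ.ne'
  obtain ⟨R₀, hR₀⟩ := hZ.exists_forall_measure_lt_norm_le hθ2
  -- Since `m` is `l⁻¹`-Lipschitz, this ball contains the `δ`-ball around `m w` whenever `‖w‖ ≤ R₀`.
  set R : ℝ := ‖m 0‖ + l⁻¹ * R₀ + δ with hR
  have hbound : ∀ w, ‖w‖ ≤ R₀ → ‖m w‖ + δ ≤ R := by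
    intro w hw
    have h1 := norm_sub_le_of_isMinOn_quadObjective hl hA hg (hm w) (hm 0)
    rw [sub_zero] at h1
    have h2 := norm_sub_norm_le (m w) (m 0)
    have h3 : l⁻¹ * ‖w‖ ≤ l⁻¹ * R₀ := by gcongr
    linarith
  -- The first bound makes `U n` a minimizer; the second gives `κR² ≤ lδ²/8`, which with `η =
  -- lδ²/16` keeps the error at most `lδ²/4 < lδ²/2`.
  set κ : ℝ := min κ₀ (l * δ ^ 2 / (8 * (R ^ 2 + 1)))
  have hκ : 0 < κ := lt_min hκ₀ (by positivity)
  have hBmeas : Tendsto (fun n => μ {ω | κ ≤ ‖B n ω - A‖}) atTop (𝓝 0) :=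
    tendstoInMeasure_iff_norm.1 (tendstoInMeasure_of_tendsto_ae hBm hB) κ hκ
  filter_upwards [hgh R (l * δ ^ 2 / 16) (by positivity), hU,
    ENNReal.tendsto_nhds_zero.1 hBmeas _ hθ2] with n hn hUn hBn
  calc μ {ω | δ ≤ ‖(U - fun n ω => m (Z n ω)) n ω - (0 : ℕ → Ω → E) n ω‖}
      ≤ μ ({ω | R₀ < ‖Z n ω‖} ∪ {ω | κ ≤ ‖B n ω - A‖}) := by
        refine measure_mono_ae ?_
        filter_upwards [hUn] with ω hω hδω
        by_contra hnot
        have hnot : ¬ (R₀ < ‖Z n ω‖ ∨ κ ≤ ‖B n ω - A‖) := hnot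
        push Not at hnot
        have hδω : δ ≤ ‖U n ω - m (Z n ω) - 0‖ := hδω
        rw [sub_zero] at hδω
        refine (norm_sub_lt_of_isMinOn_quadObjective hA (hB0 n ω) hg (hh n) (hm (Z n ω))
          (hω (hnot.2.trans_le (min_le_left _ _))) hδ (hbound _ hnot.1) hn hnot.2.le
          ?_).not_ge hδω
        have hκR : κ * (R ^ 2 + 1) ≤ l * δ ^ 2 / 8 := by
          calc κ * (R ^ 2 + 1) ≤ l * δ ^ 2 / (8 * (R ^ 2 + 1)) * (R ^ 2 + 1) := by
                gcongr; exact min_le_right _ _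
            _ = l * δ ^ 2 / 8 := by field_simp
        have : 0 < l * δ ^ 2 := by positivity
        linarith
    _ ≤ μ {ω | R₀ < ‖Z n ω‖} + μ {ω | κ ≤ ‖B n ω - A‖} := measure_union_le _ _
    _ ≤ θ / 2 + θ / 2 := by gcongr; exact hR₀ n
    _ = θ := ENNReal.add_halves θ

theorem mul_norm_sq_le_inner_of_norm_sub_lt {E : Type*} [NormedAddCommGroup E]
    [InnerProductSpace ℝ E] {A B : E →L[ℝ] E} {l : ℝ} (hA : ∀ u, l * ‖u‖ ^ 2 ≤ inner ℝ u (A u))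
    (hAB : ‖B - A‖ < l / 2) (u : E) : l / 2 * ‖u‖ ^ 2 ≤ inner ℝ u (B u) := by
  have h1 : |inner ℝ u ((B - A) u)| ≤ l / 2 * ‖u‖ ^ 2 := by
    calc |inner ℝ u ((B - A) u)| ≤ ‖u‖ * ‖(B - A) u‖ := abs_real_inner_le_norm _ _
      _ ≤ ‖u‖ * (‖B - A‖ * ‖u‖) := by gcongr; exact (B - A).le_opNorm u
      _ = ‖B - A‖ * ‖u‖ ^ 2 := by ring
      _ ≤ l / 2 * ‖u‖ ^ 2 := by gcongr
  rw [sub_apply, inner_sub_right] at h1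
  linarith [(abs_le.1 h1).1, hA u]

end Estimator

/-- The linear model has i.i.d. centered design vectors `X i` with positive definite covariance
`C`, independent of the i.i.d. centered noise `ε i` with variance `σ ^ 2`; the penalties are
`f_n = √n (f + ρ_n)` (the case `ρ_n = 0`, `c_n = 0` being `f_n = √n f`). The estimator
`βhat n` is any measurable minimizer of the penalized least squares objective (arbitrary at those
outcomes where there is no minimizer). Both argmins are well defined: that of `V` always, that of
the objective almost surely for all large `n`; and `√n (βhat n - β₀)` converges in distribution
to the argmin of `V`. -/
theorem theorem1 {p : ℕ} {Ω Ω' : Type*} [MeasurableSpace Ω] [MeasurableSpace Ω']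
    (μ : Measure Ω) [IsProbabilityMeasure μ] (ν : Measure Ω') [IsProbabilityMeasure ν]
    (C : Matrix (Fin p) (Fin p) ℝ) (hC : C.PosDef) (σ : ℝ)
    (β₀ : EuclideanSpace ℝ (Fin p))
    -- the design
    (X : ℕ → Ω → EuclideanSpace ℝ (Fin p))
    (hX_meas : ∀ i, Measurable (X i))
    (hX_indep : iIndepFun X μ)
    (hX_ident : ∀ i, IdentDistrib (X i) (X 0) μ μ)
    (hX_memLp : MemLp (X 0) 2 μ)
    (hX_mean : ∫ ω, X 0 ω ∂μ = 0)
    (hX_cov : ∀ j k, covariance (fun ω => X 0 ω j) (fun ω => X 0 ω k) μ = C j k)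
    -- the noise
    (ε : ℕ → Ω → ℝ)
    (hε_meas : ∀ i, Measurable (ε i))
    (hε_indep : iIndepFun ε μ)
    (hε_ident : ∀ i, IdentDistrib (ε i) (ε 0) μ μ)
    (hε_memLp : MemLp (ε 0) 2 μ)
    (hε_mean : ∫ ω, ε 0 ω ∂μ = 0)
    (hε_var : variance (ε 0) μ = σ ^ 2)
    (hXε : IndepFun (fun ω i => X i ω) (fun ω i => ε i ω) μ)
    -- the penalty
    (f : EuclideanSpace ℝ (Fin p) → ℝ) (hf : ConvexOn ℝ Set.univ f)
    (ρ : ℕ → EuclideanSpace ℝ (Fin p) → ℝ) (c : ℕ → ℝ≥0)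
    (hρ_conv : ∀ n : ℕ, ConvexOn ℝ Set.univ (fun β => √(n : ℝ) * (f β + ρ n β)))
    (hρ_zero : ∀ β, Tendsto (fun n => ρ n β) atTop (𝓝 0))
    (hρ_lip : ∀ n, LipschitzWith (c n) (ρ n))
    (hc : Tendsto c atTop (𝓝 0))
    -- the estimator
    (βhat : ℕ → Ω → EuclideanSpace ℝ (Fin p))
    (hβ_meas : ∀ n, AEMeasurable (βhat n) μ)
    (hβ_min : ∀ n : ℕ, ∀ᵐ ω ∂μ,
      (∃ β, IsMinOn (penalizedLS X ε β₀ (fun β => √(n : ℝ) * (f β + ρ n β)) n ω) Set.univ β) →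
        IsMinOn (penalizedLS X ε β₀ (fun β => √(n : ℝ) * (f β + ρ n β)) n ω) Set.univ
          (βhat n ω))
    -- the Gaussian vector
    (W : Ω' → EuclideanSpace ℝ (Fin p))
    (hW : HasLaw W (multivariateGaussian 0 (σ ^ 2 • C)) ν) :
    (∀ᵐ ω ∂μ, ∀ᶠ n : ℕ in atTop, ∃! β,
      IsMinOn (penalizedLS X ε β₀ (fun β => √(n : ℝ) * (f β + ρ n β)) n ω) Set.univ β) ∧
    (∀ w, ∃! u, IsMinOn (limitObjective C f β₀ w) Set.univ u) ∧
    ∀ uhat : Ω' → EuclideanSpace ℝ (Fin p),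
      (∀ᵐ ω ∂ν, IsMinOn (limitObjective C f β₀ (W ω)) Set.univ (uhat ω)) →
      TendstoInDistribution (fun (n : ℕ) ω => √(n : ℝ) • (βhat n ω - β₀)) atTop uhat
        (fun _ => μ) ν := by
  obtain ⟨l, hl, hCl⟩ := hC.exists_pos_mul_norm_sq_le
  set A := ∫ ω, InnerProductSpace.rankOne ℝ (X 0 ω) (X 0 ω) ∂μ with hAdef
  have hAC : ∀ u : EuclideanSpace ℝ (Fin p), inner ℝ u (A u) = u.ofLp ⬝ᵥ C.mulVec u.ofLp :=
    fun u => (inner_integral_rankOne_self hX_memLp u).trans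
      (integral_inner_sq_eq_dotProduct_mulVec (hX_meas 0) hX_memLp hX_mean hX_cov u)
  have hA : ∀ u, l * ‖u‖ ^ 2 ≤ inner ℝ u (A u) := fun u => (hCl u).trans_eq (hAC u).symm
  have hV : ∀ w, limitObjective C f β₀ w = quadObjective A w (dirDeriv f β₀) := by
    intro w
    ext u
    rw [limitObjective, quadObjective, hAC]
  have hg := convexOn_dirDeriv hf β₀
  have hSLLN := tendsto_empiricalSecondMoment hX_indep hX_ident hX_memLp
  have hexists : ∀ w, ∃! u, IsMinOn (limitObjective C f β₀ w) Set.univ u := by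
    intro w
    rw [hV]
    exact (strongConvexOn_quadObjective hA w hg).existsUnique_isMinOn hl
  have hunique : ∀ n : ℕ, 0 < n → ∀ ω, ‖empiricalSecondMoment X n ω - A‖ < l / 2 → ∃! β,
      IsMinOn (penalizedLS X ε β₀ (fun β => √(n : ℝ) * (f β + ρ n β)) n ω) Set.univ β :=
    fun n hn ω hω => existsUnique_isMinOn_penalizedLS X ε β₀ hn ω (hρ_conv n) (half_pos hl)
      (mul_norm_sq_le_inner_of_norm_sub_lt hA hω)
  refine ⟨?_, hexists, fun uhat huhat => ?_⟩
  · filter_upwards [hSLLN] with ω hω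
    filter_upwards [(tendsto_iff_norm_sub_tendsto_zero.1 hω).eventually_lt_const (half_pos hl),
      eventually_gt_atTop 0] with n hn hpos
    exact hunique n hpos ω hn
  · choose m hm hm_unique using hexists
    have hmA : ∀ w, IsMinOn (quadObjective A w (dirDeriv f β₀)) Set.univ (m w) :=
      fun w => hV w ▸ hm w
    have hm_cont : Continuous m := by
      refine (LipschitzWith.of_dist_le_mul (K := ⟨l⁻¹, (inv_pos.2 hl).le⟩) fun w₁ w₂ => ?_).continuous
      rw [dist_eq_norm, dist_eq_norm]
      exact norm_sub_le_of_isMinOn_quadObjective hl hA hg (hmA w₁) (hmA w₂)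
    have hscore := tendstoInDistribution_normalizedScore hC.posSemidef hX_meas hX_indep hX_ident
      hX_memLp hX_mean hX_cov hε_meas hε_indep hε_ident hε_memLp hε_mean hε_var hXε hW
    have hae : m ∘ W =ᵐ[ν] uhat := by
      filter_upwards [huhat] with ω hω
      exact (hm_unique _ _ hω).symm
    have hlim := (hscore.continuous_comp hm_cont).congr (fun _ => EventuallyEq.rfl) hae
    -- Slutsky: what remains is that the rescaled estimator and `m(Zₙ)` differ by a term vanishing
    -- in probability.
    refine tendstoInDistribution_of_tendstoInMeasure_sub _ _ hlim ?_
      (fun n => ((hβ_meas n).sub_const β₀).const_smul (√(n : ℝ)))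
    have hrank : Continuous fun y : EuclideanSpace ℝ (Fin p) => InnerProductSpace.rankOne ℝ y y := by
      simp only [InnerProductSpace.rankOne_def]
      fun_prop
    refine tendstoInMeasure_sub_argmin_quadObjective hl hA hg hmA (B := empiricalSecondMoment X)
      (fun n => ?_) hSLLN (fun n ω u => ?_) (fun n => convexOn_scaledPenalty (hρ_conv n) β₀)
      (fun R η hη => eventually_abs_scaledPenalty_sub_dirDeriv_le hf β₀ hρ_lip hc R hη) hscore
      (half_pos hl) ?_
    · exact (Finset.aestronglyMeasurable_fun_sum _ fun i _ =>
        hrank.comp_aestronglyMeasurable (hX_meas i).aestronglyMeasurable).const_smul (n : ℝ)⁻¹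
    · rw [inner_empiricalSecondMoment_self]
      positivity
    · filter_upwards [eventually_gt_atTop 0] with n hn
      filter_upwards [hβ_min n] with ω hω hclose
      exact (isMinOn_penalizedLS_iff X ε β₀ (fun β => f β + ρ n β) hn ω _).1
        (hω (hunique n hn ω hclose).exists)
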